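/- Let $\mathcal{A}$ be a unital $C^*$-algebra and let $H_{\mathcal{A}}=\ell^2(\mathcal{A})$ be the standard right Hilbert $\mathcal{A}$-module: the sequences $x=(x_i)_{i\in\mathbb{N}}$ in $\mathcal{A}$ for which $\sum_i x_i^*x_i$ converges in norm, with $\langle x,y\rangle=\sum_i x_i^*y_i$ and $\|x\|=\|\langle x,x\rangle\|^{1/2}$. Let $B^a(H_{\mathcal{A}})$ be the algebra of all bounded adjointable $\mathcal{A}$-linear operators on $H_{\mathcal{A}}$, with the operator norm. For $F\in B^a(H_{\mathcal{A}})$ consider closed $\mathcal{A}$-submodules $M_1,N_1,M_2,N_2$ of $H_{\mathcal{A}}$ such that $H_{\mathcal{A}}=M_1\,\tilde\oplus\,N_1=M_2\,\tilde\oplus\,N_2$ (direct sums, not necessarily orthogonal), $F$ restricts to an isomorphism of $M_1$ onto $M_2$ (an $\mathcal{A}$-linear bijection, bounded with bounded inverse), and $F(N_1)\subseteq N_2$. One says that $F\in\mathcal{M}\Phi_+(H_{\mathcal{A}})$ if these submodules can be chosen with $N_1$ finitely generated, that $F\in\mathcal{M}\Phi_-(H_{\mathcal{A}})$ if they can be chosen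 with $N_2$ finitely generated, and that $F\in\mathcal{M}\Phi(H_{\mathcal{A}})$ if they can be chosen with both $N_1$ and $N_2$ finitely generated. Here a module is finitely generated if it is the $\mathcal{A}$-linear span of a finite subset. **Theorem 4.1.** The sets $\mathcal{M}\Phi_+(H_{\mathcal{A}})\setminus\mathcal{M}\Phi(H_{\mathcal{A}})$ and $\mathcal{M}\Phi_-(H_{\mathcal{A}})\setminus\mathcal{M}\Phi(H_{\mathcal{A}})$ are open in $B^a(H_{\mathcal{A}})$ with respect to the norm topology. -/

import Mathlib

noncomputable section

/-! ### The standard module `H_A = ℓ²(A)` over a unital C⋆-algebra `A`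

`H_A` is the right Hilbert `A`-module of all sequences `x : ℕ → A` such that `∑ i, (x i)⋆ * x i`
converges in norm, with `⟪x, y⟫ = ∑ i, (x i)⋆ * y i` and `‖x‖ = ‖⟪x, x⟫‖ ^ (1 / 2)`. Right
`A`-modules are modules over `Aᵐᵒᵖ`, as everywhere in Mathlib. -/

namespace StdHilbert

section Summability

variable {A : Type*} [CStarAlgebra A]

theorem summable_of_nonneg_of_le [PartialOrder A] [StarOrderedRing A] {ι : Type*} {f g : ι → A}
    (hf : ∀ i, 0 ≤ f i) (hfg : ∀ i, f i ≤ g i) (hg : Summable g) : Summable f := by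
  rw [summable_iff_vanishing_norm] at hg ⊢
  intro ε hε
  obtain ⟨s, hs⟩ := hg ε hε
  refine ⟨s, fun t ht => lt_of_le_of_lt ?_ (hs t ht)⟩
  exact CStarAlgebra.norm_le_norm_of_nonneg_of_le (Finset.sum_nonneg fun i _ => hf i)
    (Finset.sum_le_sum fun i _ => hfg i)

theorem summable_add {x y : ℕ → A} (hx : Summable fun i => star (x i) * x i)
    (hy : Summable fun i => star (y i) * y i) :
    Summable fun i => star (x i + y i) * (x i + y i) := by
  let _ : PartialOrder A := CStarAlgebra.spectralOrder A
  let _ : StarOrderedRing A := CStarAlgebra.spectralOrderedRing A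
  refine summable_of_nonneg_of_le (fun i => star_mul_self_nonneg _) (fun i => ?_)
    ((hx.add hx).add (hy.add hy))
  have h : star (x i) * x i + star (x i) * x i + (star (y i) * y i + star (y i) * y i)
      = star (x i + y i) * (x i + y i) + star (x i - y i) * (x i - y i) := by
    simp only [star_add, star_sub]
    noncomm_ring
  rw [h]
  exact le_add_of_nonneg_right (star_mul_self_nonneg _)

theorem summable_op_smul {x : ℕ → A} (hx : Summable fun i => star (x i) * x i) (a : A) :
    Summable fun i => star (x i * a) * (x i * a) := by
  have h := (hx.mul_left (star a)).mul_right a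
  simpa [mul_assoc] using h

theorem summable_inner {x y : ℕ → A} (hx : Summable fun i => star (x i) * x i)
    (hy : Summable fun i => star (y i) * y i) : Summable fun i => star (x i) * y i := by
  have key : ∀ c : A, Summable fun i => star (x i + y i * c) * (x i + y i * c) := fun c =>
    summable_add hx (summable_op_smul hy c)
  have h1 := key 1
  have h2 := key (-1)
  have h3 := key (Complex.I • 1)
  have h4 := key (-(Complex.I • 1))
  have h := (((h1.sub h2).sub (h3.const_smul Complex.I)).add
    (h4.const_smul Complex.I)).const_smul (1 / 4 : ℂ)
  refine h.congr fun i => ?_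
  simp only [mul_one, mul_neg, mul_smul_comm, star_add, star_neg, star_smul, add_mul, mul_add,
    neg_mul, smul_mul_assoc, smul_add, smul_neg, smul_sub, smul_smul, Complex.star_def,
    Complex.conj_I]
  match_scalars <;> ring_nf <;> norm_num [Complex.I_sq]

end Summability

/-- The sequences `x` in `A` for which `∑ i, (x i)⋆ * x i` converges in norm, as a right
`A`-submodule of `ℕ → A`. All terms are positive, so unconditional convergence is the same as
convergence of the partial sums. -/
def squareSummable (A : Type*) [CStarAlgebra A] : Submodule Aᵐᵒᵖ (ℕ → A) where
  carrier := {x | Summable fun i => star (x i) * x i}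
  add_mem' hx hy := summable_add hx hy
  zero_mem' := by simp
  smul_mem' a _ hx := summable_op_smul hx a.unop

/-- The standard module `H_A`. It is a type of its own, so that its topology is the one of the
Hilbert module norm, not the one of pointwise convergence. -/
def HA (A : Type*) [CStarAlgebra A] : Type _ := squareSummable A

variable (A : Type*) [CStarAlgebra A]

instance : AddCommGroup (HA A) := inferInstanceAs (AddCommGroup (squareSummable A))

instance : Module Aᵐᵒᵖ (HA A) := inferInstanceAs (Module Aᵐᵒᵖ (squareSummable A))

instance : Module ℂ (HA A) := inferInstanceAs (Module ℂ (squareSummable A))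

variable {A} in
/-- The sequence of coordinates of an element of `H_A`. -/
def HA.seq (x : HA A) : ℕ → A := x.1

instance : CoeFun (HA A) (fun _ => ℕ → A) := ⟨HA.seq⟩

instance : Inner A (HA A) := ⟨fun x y => ∑' i, star (x i) * y i⟩

instance : Norm (HA A) := ⟨fun x => √‖inner A x x‖⟩

variable {A}

theorem HA.add_apply (x y : HA A) (i : ℕ) : (x + y) i = x i + y i := rfl

theorem HA.zero_apply (i : ℕ) : (0 : HA A) i = 0 := rfl

theorem HA.op_smul_apply (a : A) (x : HA A) (i : ℕ) : (MulOpposite.op a • x) i = x i * a := rfl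

theorem HA.smul_apply (c : ℂ) (x : HA A) (i : ℕ) : (c • x) i = c • x i := rfl

theorem HA.ext {x y : HA A} (h : ∀ i, x i = y i) : x = y := Subtype.ext (funext h)

theorem HA.hasSum_inner (x y : HA A) : HasSum (fun i => star (x i) * y i) (inner A x y) :=
  (summable_inner x.2 y.2).hasSum

theorem HA.inner_add_right (x y z : HA A) : inner A x (y + z) = inner A x y + inner A x z := by
  refine (HA.hasSum_inner x (y + z)).unique ?_
  simpa only [HA.add_apply, mul_add] using (HA.hasSum_inner x y).add (HA.hasSum_inner x z)

theorem HA.inner_op_smul_right (a : A) (x y : HA A) :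
    inner A x (MulOpposite.op a • y) = inner A x y * a := by
  refine (HA.hasSum_inner x (MulOpposite.op a • y)).unique ?_
  simpa only [HA.op_smul_apply, mul_assoc] using (HA.hasSum_inner x y).mul_right a

theorem HA.inner_smul_right (c : ℂ) (x y : HA A) : inner A x (c • y) = c • inner A x y := by
  refine (HA.hasSum_inner x (c • y)).unique ?_
  simpa only [HA.smul_apply, mul_smul_comm] using (HA.hasSum_inner x y).const_smul c

theorem HA.star_inner (x y : HA A) : star (inner A x y) = inner A y x := by
  refine HasSum.unique (HA.hasSum_inner x y).star ?_
  simpa only [star_mul, star_star] using HA.hasSum_inner y x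

theorem HA.inner_add_left (x y z : HA A) : inner A (x + y) z = inner A x z + inner A y z := by
  rw [← HA.star_inner, HA.inner_add_right, star_add, HA.star_inner, HA.star_inner]

theorem HA.inner_smul_left (c : ℂ) (x y : HA A) :
    inner A (c • x) y = star c • inner A x y := by
  rw [← HA.star_inner, HA.inner_smul_right, star_smul, HA.star_inner]

theorem HA.inner_self_eq_zero {x : HA A} : inner A x x = 0 ↔ x = 0 := by
  let _ : PartialOrder A := CStarAlgebra.spectralOrder A
  let _ : StarOrderedRing A := CStarAlgebra.spectralOrderedRing A
  constructor
  · intro h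
    have hs := HA.hasSum_inner x x
    rw [h] at hs
    have h0 := (hasSum_zero_iff_of_nonneg fun i => star_mul_self_nonneg (x i)).1 hs
    exact HA.ext fun i => (CStarRing.star_mul_self_eq_zero_iff _).1 (congrFun h0 i)
  · rintro rfl
    refine (HA.hasSum_inner (0 : HA A) 0).unique ?_
    simpa only [HA.zero_apply, mul_zero] using (hasSum_zero : HasSum (fun _ : ℕ => (0 : A)) 0)

/-- `H_A` is a Hilbert C⋆-module. Mathlib's `CStarModule` is about left modules, and a right
`A`-module is a left module over the opposite algebra. -/
instance [PartialOrder Aᵐᵒᵖ] [StarOrderedRing Aᵐᵒᵖ] : CStarModule Aᵐᵒᵖ (HA A) where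
  inner x y := MulOpposite.op (inner A x y)
  inner_add_right := by simp [HA.inner_add_right]
  inner_self_nonneg {x} := by
    have h := (HA.hasSum_inner x x).op
    rw [← h.tsum_eq]
    refine tsum_nonneg fun i => ?_
    rw [MulOpposite.op_mul, MulOpposite.op_star]
    exact mul_star_self_nonneg _
  inner_self := by simp [HA.inner_self_eq_zero]
  inner_op_smul_right {a x y} := MulOpposite.unop_injective (HA.inner_op_smul_right a.unop x y)
  inner_smul_right_complex := by simp [HA.inner_smul_right]
  star_inner x y := by rw [← MulOpposite.op_star, HA.star_inner]
  norm_eq_sqrt_norm_inner_self x := rfl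

theorem HA.normedSpaceCore : NormedSpace.Core ℂ (HA A) :=
  let _ : PartialOrder Aᵐᵒᵖ := CStarAlgebra.spectralOrder Aᵐᵒᵖ
  let _ : StarOrderedRing Aᵐᵒᵖ := CStarAlgebra.spectralOrderedRing Aᵐᵒᵖ
  CStarModule.normedSpaceCore Aᵐᵒᵖ

instance : NormedAddCommGroup (HA A) := NormedAddCommGroup.ofCore HA.normedSpaceCore

instance : NormedSpace ℂ (HA A) := NormedSpace.ofCore HA.normedSpaceCore

/-! ### Adjointable operators and semi-Fredholm operators -/

variable (A)

/-- `B^a(H_A)`: the algebra of all bounded `A`-linear operators on `H_A` that have an adjoint,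
with the operator norm. -/
def Ba : Subalgebra ℂ (HA A →L[ℂ] HA A) where
  carrier := {F | (∀ (a : A) (x : HA A), F (MulOpposite.op a • x) = MulOpposite.op a • F x) ∧
    ∃ G : HA A →L[ℂ] HA A, ∀ x y : HA A, inner A (F x) y = inner A x (G y)}
  mul_mem' := by
    rintro F₁ F₂ ⟨l₁, G₁, h₁⟩ ⟨l₂, G₂, h₂⟩
    refine ⟨fun a x => ?_, G₂ * G₁, fun x y => ?_⟩
    · simp [l₁, l₂]
    · simp [h₁, h₂]
  add_mem' := by
    rintro F₁ F₂ ⟨l₁, G₁, h₁⟩ ⟨l₂, G₂, h₂⟩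
    refine ⟨fun a x => ?_, G₁ + G₂, fun x y => ?_⟩
    · simp [l₁, l₂]
    · simp [HA.inner_add_left, HA.inner_add_right, h₁, h₂]
  algebraMap_mem' c := by
    refine ⟨fun a x => ?_, algebraMap ℂ _ (star c), fun x y => ?_⟩
    · simp only [Algebra.algebraMap_eq_smul_one, smul_apply,
        one_apply_eq_self]
      exact HA.ext fun i => (smul_mul_assoc c (x i) a).symm
    · simp [Algebra.algebraMap_eq_smul_one, HA.inner_smul_left, HA.inner_smul_right]

variable {A}

/-- The decompositions `H_A = M₁ ∔ N₁` (domain) and `H_A = M₂ ∔ N₂` (range) into closed submodules,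
not necessarily orthogonal, with respect to which `F` has the diagonal matrix `diag (F₁, F₄)` with
`F₁ : M₁ → M₂` an isomorphism. -/
structure IsDecomposition (F : Ba A) (M₁ N₁ M₂ N₂ : Submodule Aᵐᵒᵖ (HA A)) : Prop where
  isClosed_M₁ : IsClosed (M₁ : Set (HA A))
  isClosed_N₁ : IsClosed (N₁ : Set (HA A))
  isClosed_M₂ : IsClosed (M₂ : Set (HA A))
  isClosed_N₂ : IsClosed (N₂ : Set (HA A))
  isCompl₁ : IsCompl M₁ N₁
  isCompl₂ : IsCompl M₂ N₂
  iso : ∃ F₁ : M₁ ≃L[Aᵐᵒᵖ] M₂, ∀ x : M₁, (F₁ x : HA A) = F.1 x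
  mapsTo : ∀ x ∈ N₁, F.1 x ∈ N₂

variable (A)

/-- `MΦ₊(H_A)`: the upper semi-`A`-Fredholm operators. -/
def MPhiPlus : Set (Ba A) :=
  {F | ∃ M₁ N₁ M₂ N₂ : Submodule Aᵐᵒᵖ (HA A), IsDecomposition F M₁ N₁ M₂ N₂ ∧ N₁.FG}

/-- `MΦ₋(H_A)`: the lower semi-`A`-Fredholm operators. -/
def MPhiMinus : Set (Ba A) :=
  {F | ∃ M₁ N₁ M₂ N₂ : Submodule Aᵐᵒᵖ (HA A), IsDecomposition F M₁ N₁ M₂ N₂ ∧ N₂.FG}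

/-- `MΦ(H_A)`: the `A`-Fredholm operators. -/
def MPhi : Set (Ba A) :=
  {F | ∃ M₁ N₁ M₂ N₂ : Submodule Aᵐᵒᵖ (HA A), IsDecomposition F M₁ N₁ M₂ N₂ ∧ N₁.FG ∧ N₂.FG}

end StdHilbert

end

/-!
Over a Banach space, the compression `M₁ → M₂` of an operator stays invertible under small
perturbations `g` of `f`, and an invertible compression makes `M₁` a complement of `g⁻¹(N₂)` and
`N₂` a complement of `g(M₁)`. So a decomposition for `f` yields one for `g` with the same `M₁` and
`N₂`, and the first complement `N₁` changes only up to isomorphism. On the other hand, as soon as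
one of `N₁`, `N₂` is finitely generated, `f` is Fredholm exactly when the other one is, whichever
decomposition of `f` is used. Hence neither semi-Fredholmness nor the failure of Fredholmness is
lost under a small perturbation.
-/

namespace ModuleFredholm

open Filter Set Submodule Topology

section Algebra

variable {R E : Type*} [Ring R] [AddCommGroup E] [Module R E]

theorem fg_of_isCompl_of_codisjoint {M N P : Submodule R E} (hMN : IsCompl M N)
    (hMP : Codisjoint M P) (hP : P.FG) : N.FG := by
  have hM : M.map (N.projection M hMN.symm) = ⊥ :=
    eq_bot_iff.2 (map_le_iff_le_comap.2 fun x hx => (projection_apply_eq_zero_iff hMN.symm).2 hx)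
  have hN : P.map (N.projection M hMN.symm) = N := by
    rw [← bot_sup_eq (P.map _), ← hM, ← Submodule.map_sup, hMP.eq_top, Submodule.map_top,
      range_projection]
  exact hN ▸ hP.map _

end Algebra

section TopologicalModules

variable {R E F : Type*} [Ring R] [AddCommGroup E] [Module R E] [TopologicalSpace E]
  [AddCommGroup F] [Module R F] [TopologicalSpace F]

/-- Decompositions `E = M₁ ⊕ N₁` and `F = M₂ ⊕ N₂` into topological complements with respect to
which `f` is block diagonal, with an isomorphism `M₁ ≃ M₂` as its first block. -/
structure IsSplitting (f : E →L[R] F) (M₁ N₁ : Submodule R E) (M₂ N₂ : Submodule R F) :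
    Prop where
  isTopCompl_domain : M₁.IsTopCompl N₁
  isTopCompl_codomain : M₂.IsTopCompl N₂
  exists_equiv : ∃ e : M₁ ≃L[R] M₂, ∀ x : M₁, (e x : F) = f x
  mapsTo : MapsTo f N₁ N₂

/-- Upper semi-Fredholm maps of topological modules; finite generation over `R` plays the role of
finite dimension. -/
def IsUpperSemiFredholm (f : E →L[R] F) : Prop :=
  ∃ M₁ N₁ M₂ N₂, IsSplitting f M₁ N₁ M₂ N₂ ∧ N₁.FG

/-- Lower semi-Fredholm maps of topological modules; finite generation over `R` plays the role of
finite dimension. -/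
def IsLowerSemiFredholm (f : E →L[R] F) : Prop :=
  ∃ M₁ N₁ M₂ N₂, IsSplitting f M₁ N₁ M₂ N₂ ∧ N₂.FG

/-- Fredholm maps of topological modules. A single splitting has to witness that both `N₁` and
`N₂` are finitely generated. -/
def IsFredholm (f : E →L[R] F) : Prop :=
  ∃ M₁ N₁ M₂ N₂, IsSplitting f M₁ N₁ M₂ N₂ ∧ N₁.FG ∧ N₂.FG

namespace IsSplitting

variable {f g : E →L[R] F} {M₁ N₁ : Submodule R E} {M₂ N₂ : Submodule R F}

theorem map_eq (h : IsSplitting f M₁ N₁ M₂ N₂) : M₁.map f.toLinearMap = M₂ := by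
  obtain ⟨e, he⟩ := h.exists_equiv
  refine le_antisymm ?_ fun y hy => ⟨e.symm ⟨y, hy⟩, (e.symm ⟨y, hy⟩).2, ?_⟩
  · rintro _ ⟨x, hx, rfl⟩
    exact he ⟨x, hx⟩ ▸ (e ⟨x, hx⟩).2
  · exact (he _).symm.trans (by rw [e.apply_symm_apply])

theorem codisjoint_range (h : IsSplitting f M₁ N₁ M₂ N₂) : Codisjoint f.range N₂ :=
  h.isTopCompl_codomain.isCompl.codisjoint.mono_left (h.map_eq ▸ LinearMap.map_le_range)

theorem exists_sub_mem (h : IsSplitting f M₁ N₁ M₂ N₂) :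
    ∃ S : F →ₗ[R] E, ∀ x, x - S (f x) ∈ N₁ := by
  obtain ⟨e, he⟩ := h.exists_equiv
  let S : F →ₗ[R] E := M₁.subtype ∘ₗ e.symm.toLinearMap ∘ₗ
    M₂.projectionOnto N₂ h.isTopCompl_codomain.isCompl
  refine ⟨S, fun x => ?_⟩
  obtain ⟨m, hm, n, hn, rfl⟩ : ∃ m ∈ M₁, ∃ n ∈ N₁, m + n = x :=
    mem_sup.1 (h.isTopCompl_domain.isCompl.sup_eq_top ▸ mem_top)
  have hSm : S (f m) = m := by
    simp [S, ← he ⟨m, hm⟩]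
  have hSn : S (f n) = 0 := by
    simp [S, (projectionOnto_apply_eq_zero_iff _).2 (h.mapsTo hn)]
  rwa [map_add, map_add, hSm, hSn, add_zero, add_sub_cancel_left]

theorem fg_codomain_of_isFredholm (h : IsSplitting f M₁ N₁ M₂ N₂) (hN₁ : N₁.FG)
    (hf : IsFredholm f) : N₂.FG := by
  obtain ⟨_, _, _, Q, hQ, -, hQfg⟩ := hf
  have hrange : f.range = M₂ ⊔ N₁.map f.toLinearMap := by
    rw [← h.map_eq, ← Submodule.map_sup, h.isTopCompl_domain.isCompl.sup_eq_top,
      Submodule.map_top]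
  refine fg_of_isCompl_of_codisjoint h.isTopCompl_codomain.isCompl (codisjoint_iff.2 ?_)
    ((hN₁.map f.toLinearMap).sup hQfg)
  rw [← sup_assoc, ← hrange, hQ.codisjoint_range.eq_top]

theorem fg_domain_of_isFredholm (h : IsSplitting f M₁ N₁ M₂ N₂) (hN₂ : N₂.FG)
    (hf : IsFredholm f) : N₁.FG := by
  obtain ⟨_, K, _, _, hK, hKfg, -⟩ := hf
  obtain ⟨S, hS⟩ := hK.exists_sub_mem
  have hN₁ : N₁ ≤ N₂.map S ⊔ K := fun x hx => by
    rw [← add_sub_cancel (S (f x)) x]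
    exact add_mem_sup (mem_map_of_mem (h.mapsTo hx)) (hS x)
  exact fg_of_isCompl_of_codisjoint h.isTopCompl_domain.isCompl
    (h.isTopCompl_domain.isCompl.codisjoint.mono_right hN₁) ((hN₂.map S).sup hKfg)

theorem isFredholm_iff_fg_codomain (h : IsSplitting f M₁ N₁ M₂ N₂) (hN₁ : N₁.FG) :
    IsFredholm f ↔ N₂.FG :=
  ⟨h.fg_codomain_of_isFredholm hN₁, fun hN₂ => ⟨_, _, _, _, h, hN₁, hN₂⟩⟩

theorem isFredholm_iff_fg_domain (h : IsSplitting f M₁ N₁ M₂ N₂) (hN₂ : N₂.FG) :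
    IsFredholm f ↔ N₁.FG :=
  ⟨h.fg_domain_of_isFredholm hN₂, fun hN₁ => ⟨_, _, _, _, h, hN₁, hN₂⟩⟩

end IsSplitting

/-- The compression of `g` to a map `M₁ → M₂`, that is, its upper left block with respect to a
decomposition `F = M₂ ⊕ N₂`. -/
noncomputable def compression (g : E →L[R] F) (M₁ : Submodule R E) {M₂ N₂ : Submodule R F}
    (h : M₂.IsTopCompl N₂) : M₁ →L[R] M₂ :=
  M₂.projectionOntoL N₂ h ∘L g ∘L M₁.subtypeL

theorem IsSplitting.isInvertible_compression {f : E →L[R] F} {M₁ N₁ : Submodule R E}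
    {M₂ N₂ : Submodule R F} (h : IsSplitting f M₁ N₁ M₂ N₂) :
    (compression f M₁ h.isTopCompl_codomain).IsInvertible := by
  obtain ⟨e, he⟩ := h.exists_equiv
  refine ⟨e, ContinuousLinearMap.ext fun x => ?_⟩
  simp [compression, ← he]

section CompInvertible

variable {G : Type*} [AddCommGroup G] [Module R G] [TopologicalSpace G]
  {i : E →L[R] F} {p : F →L[R] G}

theorem isTopCompl_range_ker_of_isInvertible_comp (h : (p ∘L i).IsInvertible) :
    i.range.IsTopCompl p.ker := by
  obtain ⟨e, he⟩ := h
  have hker : ((e.symm : G →L[R] E) ∘L p).ker = p.ker := by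
    ext; simp
  rw [← hker]
  refine i.isTopCompl_range_ker_of_leftInverse _ fun x => ?_
  exact e.symm_apply_eq.2 (DFunLike.congr_fun he x).symm

theorem exists_equiv_range_of_isInvertible_comp (h : (p ∘L i).IsInvertible) :
    ∃ e : E ≃L[R] i.range, ∀ x, (e x : F) = i x := by
  obtain ⟨e, he⟩ := h
  have hleft : Function.LeftInverse (e.symm ∘ p) i := fun x =>
    e.symm_apply_eq.2 (DFunLike.congr_fun he x).symm
  refine ⟨.equivOfInverse (i.codRestrict i.range fun x => ⟨x, rfl⟩)
    ((e.symm : G →L[R] E) ∘L p ∘L i.range.subtypeL) hleft ?_, fun _ => rfl⟩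
  rintro ⟨_, x, rfl⟩
  exact Subtype.ext (congrArg i (hleft x))

end CompInvertible

theorem isSplitting_of_isInvertible_compression {g : E →L[R] F} {M₁ : Submodule R E}
    {M₂ N₂ : Submodule R F} (h : M₂.IsTopCompl N₂) (hg : (compression g M₁ h).IsInvertible) :
    IsSplitting g M₁ (N₂.comap g.toLinearMap) (M₁.map g.toLinearMap) N₂ := by
  have hrange : (g ∘L M₁.subtypeL).range = M₁.map g.toLinearMap := by
    simp [LinearMap.range_comp]
  have hker : (M₂.projectionOntoL N₂ h ∘L g).ker = N₂.comap g.toLinearMap := by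
    simp [LinearMap.ker_comp]
  refine ⟨?_, ?_, ?_, fun x hx => hx⟩
  · have hcompl := isTopCompl_range_ker_of_isInvertible_comp
      (i := M₁.subtypeL) (p := M₂.projectionOntoL N₂ h ∘L g) hg
    rwa [hker, toLinearMap_subtypeL, range_subtype] at hcompl
  · have hcompl := isTopCompl_range_ker_of_isInvertible_comp
      (i := g ∘L M₁.subtypeL) (p := M₂.projectionOntoL N₂ h) hg
    rwa [hrange, ker_projectionOntoL] at hcompl
  · exact hrange ▸ exists_equiv_range_of_isInvertible_comp
      (i := g ∘L M₁.subtypeL) (p := M₂.projectionOntoL N₂ h) hg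

end TopologicalModules

section Perturbation

theorem isTopCompl_iff_isCompl_isClosed (𝕜 : Type*) {R E : Type*} [NontriviallyNormedField 𝕜]
    [Ring R] [SMul 𝕜 R] [NormedAddCommGroup E] [NormedSpace 𝕜 E] [CompleteSpace E] [Module R E]
    [IsScalarTower 𝕜 R E] {M N : Submodule R E} :
    M.IsTopCompl N ↔ IsCompl M N ∧ IsClosed (M : Set E) ∧ IsClosed (N : Set E) := by
  refine ⟨fun h => ⟨h.isCompl, h.isClosed, h.isClosed'⟩, fun ⟨h, hM, hN⟩ => ?_⟩
  have : CompleteSpace M := hM.completeSpace_coe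
  have : CompleteSpace N := hN.completeSpace_coe
  rw [IsCompl.isTopCompl_iff_continuous_symm_prodEquivOfIsCompl h]
  exact ((M.prodEquivOfIsCompl N h).restrictScalars 𝕜).continuous_symm
    (continuous_prodEquivOfIsCompl h)

variable {𝕜 R E F X : Type*} [NontriviallyNormedField 𝕜] [Ring R] [SMul 𝕜 R]
  [NormedAddCommGroup E] [NormedSpace 𝕜 E] [Module R E] [IsScalarTower 𝕜 R E]
  [NormedAddCommGroup F] [NormedSpace 𝕜 F] [Module R F] [IsScalarTower 𝕜 R F]

theorem isInvertible_of_isInvertible_restrictScalars {f : E →L[R] F}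
    (h : (f.restrictScalars 𝕜).IsInvertible) : f.IsInvertible := by
  obtain ⟨e, he⟩ := h
  have hef : ∀ x, e x = f x := DFunLike.congr_fun he
  let e' : E ≃L[R] F :=
    { e.toEquiv with
      map_add' := e.map_add
      map_smul' := fun r x => by simp [hef]
      continuous_toFun := e.continuous
      continuous_invFun := e.symm.continuous }
  exact ⟨e', ContinuousLinearMap.ext hef⟩

variable [CompleteSpace E] [TopologicalSpace X]

theorem eventually_isInvertible {T : X → E →L[R] F} {x₀ : X}
    (hT : ContinuousAt (fun x => (T x).restrictScalars 𝕜) x₀) (h : (T x₀).IsInvertible) :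
    ∀ᶠ x in 𝓝 x₀, (T x).IsInvertible := by
  obtain ⟨e, he⟩ := h
  let e' : E ≃L[𝕜] F := ⟨e.toLinearEquiv.restrictScalars 𝕜, e.continuous, e.symm.continuous⟩
  have he' : (T x₀).restrictScalars 𝕜 = e' := by
    rw [← he]; rfl
  have hnhds : ∀ᶠ S in 𝓝 ((T x₀).restrictScalars 𝕜), S.IsInvertible := he' ▸ e'.nhds
  exact (hT.eventually hnhds).mono fun x => isInvertible_of_isInvertible_restrictScalars

theorem IsSplitting.eventually_isSplitting {T : X → E →L[R] F}
    (hT : Continuous fun x => (T x).restrictScalars 𝕜) {x₀ : X} {M₁ N₁ : Submodule R E}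
    {M₂ N₂ : Submodule R F} (h : IsSplitting (T x₀) M₁ N₁ M₂ N₂) :
    ∀ᶠ x in 𝓝 x₀, ∃ N₁' M₂', IsSplitting (T x) M₁ N₁' M₂' N₂ := by
  have : CompleteSpace M₁ := h.isTopCompl_domain.isClosed.completeSpace_coe
  let p : F →L[R] M₂ := M₂.projectionOntoL N₂ h.isTopCompl_codomain
  have hc : Continuous fun x => (compression (T x) M₁ h.isTopCompl_codomain).restrictScalars 𝕜 :=
    (continuous_const (y := p.restrictScalars 𝕜)).clm_comp
      (hT.clm_comp (continuous_const (y := M₁.subtypeL.restrictScalars 𝕜)))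
  filter_upwards [eventually_isInvertible hc.continuousAt h.isInvertible_compression] with x hx
  exact ⟨_, _, isSplitting_of_isInvertible_compression h.isTopCompl_codomain hx⟩

theorem isOpen_isUpperSemiFredholm_not_isFredholm {T : X → E →L[R] F}
    (hT : Continuous fun x => (T x).restrictScalars 𝕜) :
    IsOpen {x | IsUpperSemiFredholm (T x) ∧ ¬ IsFredholm (T x)} := by
  refine isOpen_iff_mem_nhds.2 fun x₀ ⟨⟨M₁, N₁, M₂, N₂, h, hN₁⟩, hx₀⟩ => ?_
  filter_upwards [h.eventually_isSplitting hT] with x ⟨N₁', M₂', hx⟩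
  have hN₁' : N₁'.FG := fg_of_isCompl_of_codisjoint hx.isTopCompl_domain.isCompl
    h.isTopCompl_domain.isCompl.codisjoint hN₁
  refine ⟨⟨_, _, _, _, hx, hN₁'⟩, ?_⟩
  rwa [hx.isFredholm_iff_fg_codomain hN₁', ← h.isFredholm_iff_fg_codomain hN₁]

theorem isOpen_isLowerSemiFredholm_not_isFredholm {T : X → E →L[R] F}
    (hT : Continuous fun x => (T x).restrictScalars 𝕜) :
    IsOpen {x | IsLowerSemiFredholm (T x) ∧ ¬ IsFredholm (T x)} := by
  refine isOpen_iff_mem_nhds.2 fun x₀ ⟨⟨M₁, N₁, M₂, N₂, h, hN₂⟩, hx₀⟩ => ?_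
  filter_upwards [h.eventually_isSplitting hT] with x ⟨N₁', M₂', hx⟩
  refine ⟨⟨_, _, _, _, hx, hN₂⟩, fun hx' => hx₀ ((h.isFredholm_iff_fg_domain hN₂).2 ?_)⟩
  exact fg_of_isCompl_of_codisjoint h.isTopCompl_domain.isCompl
    hx.isTopCompl_domain.isCompl.codisjoint ((hx.isFredholm_iff_fg_domain hN₂).1 hx')

end Perturbation

end ModuleFredholm

namespace StdHilbert

open Filter Topology ModuleFredholm

variable {A : Type*} [CStarAlgebra A]

section Completeness

/-- The sequence that agrees with `y` on `s` and vanishes elsewhere, as an element of `H_A`. Its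
norm turns the partial sums of `∑ i, (y i)⋆ * y i` into norms of `H_A`, for an arbitrary `y`. -/
noncomputable def truncation (s : Finset ℕ) (y : ℕ → A) : HA A :=
  ⟨(s : Set ℕ).indicator y, summable_of_ne_finset_zero (s := s) fun i hi => by
    simp [Set.indicator_of_notMem (Finset.mem_coe.not.2 hi)]⟩

theorem truncation_sub (s : Finset ℕ) (y z : ℕ → A) :
    truncation s (y - z) = truncation s y - truncation s z :=
  Subtype.ext (Set.indicator_sub _ y z)

theorem HA.norm_sq (x : HA A) : ‖x‖ ^ 2 = ‖inner A x x‖ := Real.sq_sqrt (norm_nonneg _)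

theorem norm_truncation_sq (s : Finset ℕ) (y : ℕ → A) :
    ‖truncation s y‖ ^ 2 = ‖∑ i ∈ s, star (y i) * y i‖ := by
  have hy : ∀ i ∈ s, truncation s y i = y i := fun i hi => Set.indicator_of_mem hi y
  have hy' : ∀ i ∉ s, truncation s y i = 0 := fun i hi => Set.indicator_of_notMem hi y
  have hsum : inner A (truncation s y) (truncation s y) = ∑ i ∈ s, star (y i) * y i :=
    (tsum_eq_sum fun i hi => by rw [hy' i hi, mul_zero]).trans
      (Finset.sum_congr rfl fun i hi => by rw [hy i hi])
  rw [HA.norm_sq, hsum]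

theorem continuous_norm_truncation (s : Finset ℕ) :
    Continuous fun y : ℕ → A => ‖truncation s y‖ := by
  have h : (fun y : ℕ → A => ‖truncation s y‖) = fun y => √‖∑ i ∈ s, star (y i) * y i‖ :=
    funext fun y => by rw [← norm_truncation_sq, Real.sqrt_sq (norm_nonneg _)]
  rw [h]
  fun_prop

theorem norm_truncation_le (s : Finset ℕ) (x : HA A) : ‖truncation s x‖ ≤ ‖x‖ := by
  let _ : PartialOrder A := CStarAlgebra.spectralOrder A
  let _ : StarOrderedRing A := CStarAlgebra.spectralOrderedRing A
  refine le_of_sq_le_sq ?_ (norm_nonneg _)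
  rw [norm_truncation_sq, HA.norm_sq]
  exact CStarAlgebra.norm_le_norm_of_nonneg_of_le
    (Finset.sum_nonneg fun i _ => star_mul_self_nonneg _)
    (sum_le_hasSum s (fun i _ => star_mul_self_nonneg _) (HA.hasSum_inner x x))

theorem norm_le_of_forall_norm_truncation_le {x : HA A} {C : ℝ}
    (h : ∀ s, ‖truncation s x‖ ≤ C) : ‖x‖ ≤ C := by
  have hC : 0 ≤ C := (norm_nonneg _).trans (h ∅)
  refine le_of_sq_le_sq ?_ hC
  rw [HA.norm_sq]
  refine le_of_tendsto (HA.hasSum_inner x x).norm (.of_forall fun s => ?_)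
  rw [← norm_truncation_sq]
  exact pow_le_pow_left₀ (norm_nonneg _) (h s) 2

theorem mem_squareSummable_iff {y : ℕ → A} :
    y ∈ squareSummable A ↔ ∀ ε > 0, ∃ s, ∀ t, Disjoint t s → ‖truncation t y‖ < ε := by
  refine summable_iff_vanishing_norm.trans ⟨fun h ε hε => ?_, fun h ε hε => ?_⟩
  · obtain ⟨s, hs⟩ := h (ε ^ 2) (by positivity)
    refine ⟨s, fun t ht => lt_of_pow_lt_pow_left₀ 2 hε.le ?_⟩
    rw [norm_truncation_sq]
    exact hs t ht
  · obtain ⟨s, hs⟩ := h √ε (by positivity)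
    refine ⟨s, fun t ht => ?_⟩
    rw [← norm_truncation_sq, ← Real.sq_sqrt hε.le]
    exact pow_lt_pow_left₀ (hs t ht) (norm_nonneg _) two_ne_zero

theorem HA.norm_apply_le (x : HA A) (i : ℕ) : ‖x i‖ ≤ ‖x‖ := by
  have h : ‖truncation {i} x‖ ^ 2 = ‖x i‖ ^ 2 := by
    rw [norm_truncation_sq, Finset.sum_singleton, CStarRing.norm_star_mul_self, sq]
  exact (le_of_sq_le_sq h.ge (norm_nonneg _)).trans (norm_truncation_le {i} x)

theorem exists_tendsto_coordinatewise {u : ℕ → HA A} (hu : CauchySeq u) :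
    ∃ y : ℕ → A, Tendsto (fun n => (u n).seq) atTop (𝓝 y) := by
  have hcoord : ∀ i, CauchySeq fun n => u n i := fun i => by
    rw [Metric.cauchySeq_iff] at hu ⊢
    intro ε hε
    obtain ⟨N, hN⟩ := hu ε hε
    refine ⟨N, fun m hm n hn => lt_of_le_of_lt ?_ (hN m hm n hn)⟩
    rw [dist_eq_norm, dist_eq_norm]
    exact HA.norm_apply_le (u m - u n) i
  choose y hy using fun i => cauchySeq_tendsto_of_complete (hcoord i)
  exact ⟨y, tendsto_pi_nhds.2 hy⟩

theorem exists_forall_norm_truncation_sub_le {u : ℕ → HA A} (hu : CauchySeq u) {y : ℕ → A}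
    (hy : Tendsto (fun n => (u n).seq) atTop (𝓝 y)) {ε : ℝ} (hε : 0 < ε) :
    ∃ N, ∀ n ≥ N, ∀ s, ‖truncation s ((u n).seq - y)‖ ≤ ε := by
  obtain ⟨N, hN⟩ := Metric.cauchySeq_iff.1 hu ε hε
  refine ⟨N, fun n hn s => ?_⟩
  refine le_of_tendsto (((continuous_norm_truncation s).tendsto _).comp (hy.const_sub (u n).seq))
    (eventually_atTop.2 ⟨N, fun m hm => ?_⟩)
  calc ‖truncation s ((u n).seq - (u m).seq)‖ ≤ ‖u n - u m‖ := norm_truncation_le s (u n - u m)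
    _ ≤ ε := by rw [← dist_eq_norm]; exact (hN n hn m hm).le

theorem mem_squareSummable_of_forall_exists {y : ℕ → A}
    (h : ∀ ε > 0, ∃ x : HA A, ∀ s, ‖truncation s (x.seq - y)‖ ≤ ε) : y ∈ squareSummable A := by
  refine mem_squareSummable_iff.2 fun ε hε => ?_
  obtain ⟨x, hx⟩ := h (ε / 2) (half_pos hε)
  obtain ⟨s, hs⟩ := mem_squareSummable_iff.1 x.2 (ε / 2) (half_pos hε)
  refine ⟨s, fun t ht => ?_⟩
  calc ‖truncation t y‖ = ‖truncation t x - truncation t (x.seq - y)‖ := by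
        rw [truncation_sub, sub_sub_cancel]
    _ ≤ ‖truncation t x‖ + ‖truncation t (x.seq - y)‖ := norm_sub_le _ _
    _ < ε / 2 + ε / 2 := add_lt_add_of_lt_of_le (hs t ht) (hx t)
    _ = ε := add_halves ε

instance : CompleteSpace (HA A) := by
  refine Metric.complete_of_cauchySeq_tendsto fun u hu => ?_
  obtain ⟨y, hy⟩ := exists_tendsto_coordinatewise hu
  have hy_mem : y ∈ squareSummable A := mem_squareSummable_of_forall_exists fun ε hε => by
    obtain ⟨N, hN⟩ := exists_forall_norm_truncation_sub_le hu hy hε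
    exact ⟨u N, hN N le_rfl⟩
  let z : HA A := ⟨y, hy_mem⟩
  refine ⟨z, Metric.tendsto_atTop'.2 fun ε hε => ?_⟩
  obtain ⟨N, hN⟩ := exists_forall_norm_truncation_sub_le hu hy (half_pos hε)
  refine ⟨N, fun n hn => ?_⟩
  rw [dist_eq_norm]
  exact (norm_le_of_forall_norm_truncation_le (x := u n - z) (hN n hn.le)).trans_lt
    (half_lt_self hε)

end Completeness

instance : IsScalarTower ℂ Aᵐᵒᵖ (HA A) :=
  ⟨fun c a x => HA.ext fun i => mul_smul_comm c (x i) a.unop⟩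

/-- An adjointable operator as a continuous `A`-linear map. -/
noncomputable def toModuleCLM (F : Ba A) : HA A →L[Aᵐᵒᵖ] HA A where
  toFun := F.1
  map_add' := map_add F.1
  map_smul' a := F.2.1 a.unop
  cont := F.1.continuous

theorem continuous_restrictScalars_toModuleCLM :
    Continuous fun F : Ba A => (toModuleCLM F).restrictScalars ℂ :=
  continuous_subtype_val

theorem isDecomposition_iff_isSplitting {F : Ba A} {M₁ N₁ M₂ N₂ : Submodule Aᵐᵒᵖ (HA A)} :
    IsDecomposition F M₁ N₁ M₂ N₂ ↔ IsSplitting (toModuleCLM F) M₁ N₁ M₂ N₂ := by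
  constructor
  · rintro ⟨hM₁, hN₁, hM₂, hN₂, h₁, h₂, hiso, hmaps⟩
    exact ⟨(isTopCompl_iff_isCompl_isClosed ℂ).2 ⟨h₁, hM₁, hN₁⟩,
      (isTopCompl_iff_isCompl_isClosed ℂ).2 ⟨h₂, hM₂, hN₂⟩, hiso, hmaps⟩
  · rintro ⟨h₁, h₂, hiso, hmaps⟩
    exact ⟨h₁.isClosed, h₁.isClosed', h₂.isClosed, h₂.isClosed', h₁.isCompl, h₂.isCompl, hiso,
      hmaps⟩

theorem mPhiPlus_eq : MPhiPlus A = {F | IsUpperSemiFredholm (toModuleCLM F)} := by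
  simp only [MPhiPlus, IsUpperSemiFredholm, isDecomposition_iff_isSplitting]

theorem mPhiMinus_eq : MPhiMinus A = {F | IsLowerSemiFredholm (toModuleCLM F)} := by
  simp only [MPhiMinus, IsLowerSemiFredholm, isDecomposition_iff_isSplitting]

theorem mPhi_eq : MPhi A = {F | IsFredholm (toModuleCLM F)} := by
  simp only [MPhi, IsFredholm, isDecomposition_iff_isSplitting]

end StdHilbert

open ModuleFredholm in
theorem theorem4p1_general {𝕜 R E F X : Type*} [NontriviallyNormedField 𝕜] [Ring R] [SMul 𝕜 R]
    [NormedAddCommGroup E] [NormedSpace 𝕜 E] [CompleteSpace E] [Module R E] [IsScalarTower 𝕜 R E]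
    [NormedAddCommGroup F] [NormedSpace 𝕜 F] [Module R F] [IsScalarTower 𝕜 R F]
    [TopologicalSpace X] {T : X → E →L[R] F} (hT : Continuous fun x => (T x).restrictScalars 𝕜) :
    IsOpen {x | IsUpperSemiFredholm (T x) ∧ ¬ IsFredholm (T x)} ∧
      IsOpen {x | IsLowerSemiFredholm (T x) ∧ ¬ IsFredholm (T x)} :=
  ⟨isOpen_isUpperSemiFredholm_not_isFredholm hT, isOpen_isLowerSemiFredholm_not_isFredholm hT⟩

theorem theorem4p1 (A : Type*) [CStarAlgebra A] :
    IsOpen (StdHilbert.MPhiPlus A \ StdHilbert.MPhi A) ∧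
      IsOpen (StdHilbert.MPhiMinus A \ StdHilbert.MPhi A) := by
  rw [StdHilbert.mPhiPlus_eq, StdHilbert.mPhiMinus_eq, StdHilbert.mPhi_eq]
  exact theorem4p1_general StdHilbert.continuous_restrictScalars_toModuleCLM
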